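/- All graphs are finite, undirected and simple; $\mathbb{N}=\{1,2,\dots\}$. For a graph $G$ and $A,B\subseteq V(G)$, let $G\oplus(A,B)$ be the graph on $V(G)$ in which two distinct vertices $u,v$ are adjacent if and only if either $(u,v)\in(A\times B)\cup(B\times A)$ and $uv\notin E(G)$, or $(u,v)\notin(A\times B)\cup(B\times A)$ and $uv\in E(G)$. A $k$-flip of $G$ is a graph $G\oplus(A_1,B_1)\oplus\cdots\oplus(A_m,B_m)$ such that all $A_i,B_i$ are parts of one partition of $V(G)$ into at most $k$ parts. In the flipper game of radius $r\in\mathbb{N}\cup\{\infty\}$ and width $k\in\mathbb{N}$ on $G$, put $G_0=G$; the runner chooses a vertex $v_0$; in each round $i\ge 1$ the flipper announces a $k$-flip $G_i$ of $G$, and then the runner, knowing $G_i$, moves from $v_{i-1}$ to a vertex $v_i$ along a path of length at most $r$ (possibly $0$) in $G_{i-1}$. The flipper wins if in some round $i\ge 1$ the vertex $v_i$ is isolated in $G_i$. The radius-$r$ flip-width $\mathrm{fw}_r(G)$ is the minimum $k\in\mathbb{N}$ for which the flipper has a winning strategy. Let $P$ be the path $p_1p_2p_3p_4$ on four vertices.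 Let $C_5$ be the cycle on five vertices, and let the bull, the gem and the co-gem be the graphs obtained from $P$ by adding one vertex adjacent to exactly $p_2$ and $p_3$, to all of $p_1,\dots,p_4$, and to none of them, respectively. A graph is $(C_5,\text{bull},\text{gem},\text{co-gem})$-free if it has no induced subgraph isomorphic to one of these four graphs. A bi-join in $G$ is a pair $(V_1,V_2)$ of disjoint nonempty sets with union $V(G)$ for which there are $W_1\subseteq V_1$ and $W_2\subseteq V_2$ such that every vertex of $W_1$ is adjacent to all of $W_2$ and to no vertex of $V_2\setminus W_2$, and every vertex of $V_1\setminus W_1$ is adjacent to all of $V_2\setminus W_2$ and to no vertex of $W_2$. A graph is totally decomposable with respect to bi-joins if each of its induced subgraphs on at least $4$ vertices has a bi-join $(V_1,V_2)$ with $|V_1|\ge 2$ and $|V_2|\ge 2$. **Theorem.** (1) For every $r\in(\mathbb{N}\setminus\{1\})\cup\{\infty\}$ and every graph $G$, $\mathrm{fw}_r(G)\le 2$ if and only if $G$ is $(C_5,\text{bull},\text{gem},\text{co-gem})$-free. (2) A graph is $(C_5,\text{bull},\text{gem},\text{co-gem})$-free if and only if it is totally decomposable with respect to bi-joins. (3)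 If $G$ is $(C_5,\text{bull},\text{gem},\text{co-gem})$-free, then $\mathrm{fw}_r(G)\le 2$ for every $r\in\mathbb{N}\cup\{\infty\}$, including $r=1$. (4) For every $r\in(\mathbb{N}\setminus\{1\})\cup\{\infty\}$, each of $C_5$, the bull, the gem and the co-gem has radius-$r$ flip-width at least $3$. -/

import Mathlib

universe u

namespace FlipWidth

variable {V : Type u}

/-- `G ⊕ (A, B)`: the adjacency of distinct `u`, `v` is complemented exactly when
`(u, v) ∈ (A × B) ∪ (B × A)`. -/
def flipPair (G : SimpleGraph V) (A B : Set V) : SimpleGraph V where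
  Adj u v := u ≠ v ∧
    (((u, v) ∈ A ×ˢ B ∪ B ×ˢ A ∧ ¬ G.Adj u v) ∨ ((u, v) ∉ A ×ˢ B ∪ B ×ˢ A ∧ G.Adj u v))
  symm := ⟨by
    intro u v h
    simp only [Set.mem_union, Set.mem_prod, G.adj_comm v u] at h ⊢
    tauto⟩
  loopless := ⟨fun _ h => h.1 rfl⟩

/-- `G ⊕ (A₁, B₁) ⊕ ⋯ ⊕ (Aₘ, Bₘ)`. -/
def flipList (G : SimpleGraph V) (S : List (Set V × Set V)) : SimpleGraph V :=
  S.foldl (fun H p => flipPair H p.1 p.2) G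

/-- `G'` is a `P`-flip of `G`: it arises by flipping pairs of (possibly equal) parts of `P`. -/
def IsFlip (G : SimpleGraph V) (P : Set (Set V)) (G' : SimpleGraph V) : Prop :=
  ∃ S : List (Set V × Set V), (∀ p ∈ S, p.1 ∈ P ∧ p.2 ∈ P) ∧ G' = flipList G S

/-- `G'` is a `k`-flip of `G`: a `P`-flip for a partition `P` of the vertex set into at most
`k` (nonempty) parts. -/
def IsKFlip (k : ℕ) (G G' : SimpleGraph V) : Prop :=
  ∃ P : Set (Set V), Setoid.IsPartition P ∧ P.encard ≤ k ∧ IsFlip G P G'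

/-- There is a path of length at most `r` from `u` to `v` in `H`; staying put is allowed. -/
def CanMove (r : ℕ∞) (H : SimpleGraph V) (u v : V) : Prop :=
  ∃ p : H.Walk u v, p.IsPath ∧ (p.length : ℕ∞) ≤ r

/-- A strategy of the flipper in the flipper game of width `k` on `G`: in round `i ≥ 1` the flipper
sees the positions `[v₀, …, v_{i-1}]` taken so far by the runner and announces a `k`-flip of `G`. -/
structure Strategy (G : SimpleGraph V) (k : ℕ) where
  move : List V → SimpleGraph V
  isKFlip : ∀ l, IsKFlip k G (move l)

namespace Strategy

variable {G : SimpleGraph V} {k : ℕ}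

/-- The graph `Gᵢ` when the runner takes the positions `v 0, v 1, …`: `G₀ = G`, and `Gᵢ` for
`i ≥ 1` is the answer of the strategy to `[v 0, …, v (i - 1)]`. -/
def graphAt (σ : Strategy G k) (v : ℕ → V) : ℕ → SimpleGraph V
  | 0 => G
  | i + 1 => σ.move ((List.range (i + 1)).map v)

/-- The runner's positions obey the rules of the game of radius `r` against `σ`: the new position
`vᵢ` is reached from `v_{i-1}` by a path of length at most `r` in the previous graph `G_{i-1}`. -/
def IsPlay (σ : Strategy G k) (r : ℕ∞) (v : ℕ → V) : Prop :=
  ∀ i, CanMove r (σ.graphAt v i) (v i) (v (i + 1))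

/-- Against `σ`, the runner is always caught: in some round `i ≥ 1` the position `vᵢ` is isolated
in `Gᵢ`. -/
def IsWinning (σ : Strategy G k) (r : ℕ∞) : Prop :=
  ∀ v : ℕ → V, σ.IsPlay r v → ∃ i, 1 ≤ i ∧ (σ.graphAt v i).IsIsolated (v i)

end Strategy

/-- The radius-`r` flip-width of `G`: the minimum `k ≥ 1` for which the flipper has a winning
strategy in the flipper game of radius `r` and width `k`. -/
noncomputable def flipWidth (r : ℕ∞) (G : SimpleGraph V) : ℕ∞ :=
  ⨅ (k : ℕ) (_ : 1 ≤ k ∧ ∃ σ : Strategy G k, σ.IsWinning r), (k : ℕ∞)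

/-- The cycle on five vertices. -/
abbrev c5 : SimpleGraph (Fin 5) := SimpleGraph.cycleGraph 5

/-- The path `0, 1, 2, 3` with a vertex `4` adjacent to `1` and `2`. -/
def bull : SimpleGraph (Fin 5) :=
  SimpleGraph.fromRel fun a b => (a, b) ∈ [(0, 1), (1, 2), (2, 3), (4, 1), (4, 2)]

/-- The path `0, 1, 2, 3` with a vertex `4` adjacent to all of its vertices. -/
def gem : SimpleGraph (Fin 5) :=
  SimpleGraph.fromRel fun a b =>
    (a, b) ∈ [(0, 1), (1, 2), (2, 3), (4, 0), (4, 1), (4, 2), (4, 3)]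

/-- The path `0, 1, 2, 3` with an isolated vertex `4`. -/
def coGem : SimpleGraph (Fin 5) :=
  SimpleGraph.fromRel fun a b => (a, b) ∈ [(0, 1), (1, 2), (2, 3)]

/-- `G` has no induced subgraph isomorphic to `C₅`, the bull, the gem or the co-gem. -/
def ObsFree (G : SimpleGraph V) : Prop :=
  ¬ c5.IsIndContained G ∧ ¬ bull.IsIndContained G ∧ ¬ gem.IsIndContained G ∧
    ¬ coGem.IsIndContained G

/-- `A` is complete to `B`. -/
def CompleteTo (G : SimpleGraph V) (A B : Set V) : Prop :=
  ∀ a ∈ A, ∀ b ∈ B, G.Adj a b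

/-- `A` is anti-complete to `B`. -/
def AnticompleteTo (G : SimpleGraph V) (A B : Set V) : Prop :=
  ∀ a ∈ A, ∀ b ∈ B, ¬ G.Adj a b

/-- The ordered bipartition `(V₁, V₂)` of the vertex set is a bi-join in `G`. -/
def IsBiJoin (G : SimpleGraph V) (V₁ V₂ : Set V) : Prop :=
  V₁.Nonempty ∧ V₂.Nonempty ∧ V₁ ∩ V₂ = ∅ ∧ V₁ ∪ V₂ = Set.univ ∧
    ∃ W₁ ⊆ V₁, ∃ W₂ ⊆ V₂,
      CompleteTo G W₁ W₂ ∧ AnticompleteTo G W₁ (V₂ \ W₂) ∧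
      CompleteTo G (V₁ \ W₁) (V₂ \ W₂) ∧ AnticompleteTo G (V₁ \ W₁) W₂

/-- `G` is completely (totally) decomposable with respect to bi-joins: every induced subgraph on at
least four vertices has a bi-join both of whose sides have more than one vertex. -/
def CompletelyDecomposable (G : SimpleGraph V) : Prop :=
  ∀ S : Set V, 4 ≤ S.encard →
    ∃ V₁ V₂ : Set S, IsBiJoin (G.induce S) V₁ V₂ ∧ V₁.encard ≠ 1 ∧ V₂.encard ≠ 1

end FlipWidth

/-! The link is Seidel switching: every switching of the co-gem is one of the four obstructions
(`exists_obstruction_switch`). Switching an obstruction-free graph so that a vertex `v` becomes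
isolated leaves no induced P4, since such a path and `v` would form a co-gem. So the graph is a
switching of a cograph (`ObsFree.exists_p4Free_switch`), where every set of at least two vertices
splits into two parts complete or anticomplete to each other.

Flipper: 2-flips include all switchings and their complements. One 2-flip cuts the two halves of a
split module off from each other and from the rest (`exists_isKFlip_isSeparated`), so the runner is
confined to shrinking modules whatever the radius.

Runner: on an obstruction, each flip along two parts leaves at most one of the vertices 0, 1, 2, 3
without another of them within distance two, so staying or moving to a nearby one is always safe
(`RunnerSafe.not_isWinning`).

Bi-joins: a nonempty proper module of a switching is a side of a bi-join, and a cograph on four or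
more vertices has a module with two vertices inside and two outside. Conversely, the obstructions
have no bi-join with two vertices on each side. -/

namespace FlipWidth

/-! ### Flips along at most two parts as Boolean functions -/

section Flips

variable {V : Type u}

theorem flipPair_adj {G : SimpleGraph V} {A B : Set V} {u v : V} (h : u ≠ v) :
    (flipPair G A B).Adj u v ↔
      (G.Adj u v ↔ ¬ ((u ∈ A ∧ v ∈ B) ∨ (u ∈ B ∧ v ∈ A))) := by
  simp only [flipPair, Set.mem_union, Set.mem_prod]
  tauto

/-- The parts of a partition into at most two parts are fibres of a two-valued function. -/
theorem exists_bool_fibres {P : Set (Set V)} (hP : Setoid.IsPartition P) (h2 : P.encard ≤ 2) :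
    ∃ t : V → Bool, ∀ A ∈ P, ∃ b, A = {u | t u = b} := by
  classical
  rcases P.eq_empty_or_nonempty with rfl | ⟨A, hA⟩
  · exact ⟨fun _ => true, by simp⟩
  refine ⟨fun u => decide (u ∈ A), fun B hB => ?_⟩
  by_cases hBA : B = A
  · exact ⟨true, by ext u; simp [hBA]⟩
  refine ⟨false, Set.ext fun u => ?_⟩
  simp only [Set.mem_ofPred_eq, decide_eq_false_iff_not]
  obtain ⟨C, ⟨hC, huC⟩, hun⟩ := hP.2 u
  constructor
  · intro hu hu'
    exact hBA ((hun B ⟨hB, hu⟩).trans (hun A ⟨hA, hu'⟩).symm)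
  · intro hu
    by_contra hu'
    have h3 : ({A, B, C} : Set (Set V)).encard = 3 := by
      rw [Set.encard_eq_three]
      refine ⟨A, B, C, fun h => hBA h.symm, ?_, ?_, rfl⟩
      · rintro rfl; exact hu huC
      · rintro rfl; exact hu' huC
    have hs : ({A, B, C} : Set (Set V)) ⊆ P := by
      rintro _ (rfl | rfl | rfl) <;> assumption
    have := (h3.symm.le.trans (Set.encard_le_encard hs)).trans h2
    exact absurd this (by decide)

/-- A flip along a partition into at most two parts complements the adjacency of `u ≠ v` according
to a symmetric function of the parts of `u` and `v`. -/
theorem IsKFlip.exists_bool {k : ℕ} (hk : k ≤ 2) {G K : SimpleGraph V} (h : IsKFlip k G K) :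
    ∃ (t : V → Bool) (F : Bool → Bool → Bool), (∀ x y, F x y = F y x) ∧
      ∀ u v, u ≠ v → (K.Adj u v ↔ (G.Adj u v ↔ F (t u) (t v) = false)) := by
  classical
  obtain ⟨P, hP, hc, S, hS, rfl⟩ := h
  obtain ⟨t, ht⟩ := exists_bool_fibres hP (hc.trans (by exact_mod_cast hk))
  refine ⟨t, ?_⟩
  induction S using List.reverseRecOn with
  | nil => exact ⟨fun _ _ => false, by simp, by simp [flipList]⟩
  | append_singleton S p ih =>
    obtain ⟨F, hF, hadj⟩ := ih fun q hq => hS q (by simp [hq])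
    obtain ⟨h1, h2⟩ := hS p (by simp)
    obtain ⟨a, ha⟩ := ht _ h1
    obtain ⟨b, hb⟩ := ht _ h2
    refine ⟨fun x y => F x y ^^ ((x == a && y == b) || (x == b && y == a)), ?_, ?_⟩
    · intro x y
      simp only [hF x y]
      congr 1
      cases x <;> cases y <;> cases a <;> cases b <;> rfl
    · intro u v huv
      have : flipList G (S ++ [p]) = flipPair (flipList G S) p.1 p.2 := by simp [flipList]
      rw [this, flipPair_adj huv, hadj u v huv, ha, hb]
      simp only [Set.mem_ofPred_eq]
      generalize t u = x
      generalize t v = y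
      by_cases hG : G.Adj u v <;> simp only [hG, true_iff, false_iff] <;>
      cases F x y <;> cases x <;> cases y <;> cases a <;> cases b <;> simp

theorem isKFlip_self {k : ℕ} (hk : 1 ≤ k) (G : SimpleGraph V) : IsKFlip k G G := by
  refine ⟨(⊤ : Setoid V).classes, Setoid.isPartition_classes _, ?_, [], by simp, rfl⟩
  refine le_trans ?_ (show (1 : ℕ∞) ≤ k by exact_mod_cast hk)
  rw [Set.encard_le_one_iff]
  rintro _ _ ⟨x, rfl⟩ ⟨y, rfl⟩
  ext; simp

theorem flipPair_empty (G : SimpleGraph V) {A B : Set V} (h : A = ∅ ∨ B = ∅) :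
    flipPair G A B = G := by
  ext u v
  rcases eq_or_ne u v with rfl | huv
  · simp
  · rw [flipPair_adj huv]
    rcases h with rfl | rfl <;> simp

/-- Empty sets are not parts but flip nothing; admitting them lets fibres of a constant colouring be
used. -/
theorem IsFlip.flipPair {G K : SimpleGraph V} {P : Set (Set V)} {A B : Set V} (h : IsFlip G P K)
    (hA : A ∈ P ∨ A = ∅) (hB : B ∈ P ∨ B = ∅) : IsFlip G P (flipPair K A B) := by
  by_cases he : A = ∅ ∨ B = ∅
  · rwa [flipPair_empty K he]
  obtain ⟨S, hS, rfl⟩ := h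
  rw [not_or] at he
  refine ⟨S ++ [(A, B)], ?_, by simp [flipList]⟩
  intro p hp
  rcases List.mem_append.1 hp with hp | hp
  · exact hS p hp
  · rw [List.mem_singleton.1 hp]
    exact ⟨hA.resolve_right he.1, hB.resolve_right he.2⟩

/-- Complementing the adjacency of `u ≠ v` by the parity of `c`, `t u` and `t v` is a 2-flip. -/
theorem exists_isKFlip_two (G : SimpleGraph V) (t : V → Bool) (c : Bool) :
    ∃ K, IsKFlip 2 G K ∧
      ∀ u v, u ≠ v → (K.Adj u v ↔ (G.Adj u v ↔ (c ^^ t u ^^ t v) = false)) := by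
  have hmem : ∀ b, {u | t u = b} ∈ (Setoid.ker t).classes ∨ {u | t u = b} = ∅ := by
    intro b
    by_cases h : ∃ x, t x = b
    · obtain ⟨x, rfl⟩ := h
      exact Or.inl ((Setoid.ker t).mem_classes x)
    · exact Or.inr (Set.eq_empty_of_forall_notMem fun x hx => h ⟨x, hx⟩)
  have hcard : (Setoid.ker t).classes.encard ≤ (2 : ℕ) := by
    refine (Set.encard_le_encard (Setoid.classes_ker_subset_fiber_set t)).trans ?_
    rw [← Set.image_univ]
    refine (Set.encard_image_le _ _).trans ?_
    rw [Set.encard_univ, ENat.card_eq_coe_fintype_card, Fintype.card_bool]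
  have hG : IsFlip G (Setoid.ker t).classes G := ⟨[], by simp, rfl⟩
  cases c
  -- For `c = false`, flip between the two fibres; for `c = true`, flip inside each.
  · refine ⟨_, ⟨_, Setoid.isPartition_classes _, hcard, hG.flipPair (hmem true) (hmem false)⟩, ?_⟩
    intro u v huv
    rw [flipPair_adj huv]
    simp only [Set.mem_ofPred_eq]
    cases t u <;> cases t v <;> simp
  · refine ⟨_, ⟨_, Setoid.isPartition_classes _, hcard,
      (hG.flipPair (hmem true) (hmem true)).flipPair (hmem false) (hmem false)⟩, ?_⟩
    intro u v huv
    rw [flipPair_adj huv, flipPair_adj huv]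
    simp only [Set.mem_ofPred_eq]
    cases t u <;> cases t v <;> simp

end Flips

/-! ### Finite checks on the four obstructions -/

section Obstructions

instance : DecidableRel bull.Adj := by unfold bull; infer_instance

instance : DecidableRel gem.Adj := by unfold gem; infer_instance

instance : DecidableRel coGem.Adj := by unfold coGem; infer_instance

/-- Adjacency in the flip of `H` determined by `t` and `F`. -/
def FlipAdj (H : SimpleGraph (Fin 5)) (t : Fin 5 → Bool) (F : Bool → Bool → Bool)
    (u v : Fin 5) : Prop :=
  u ≠ v ∧ (H.Adj u v ↔ F (t u) (t v) = false)

instance (H : SimpleGraph (Fin 5)) [DecidableRel H.Adj] (t : Fin 5 → Bool)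
    (F : Bool → Bool → Bool) : DecidableRel (FlipAdj H t F) := by
  unfold FlipAdj; infer_instance

/-- Another vertex of `{0, 1, 2, 3}` is at distance at most two from `i`. -/
def HasNear (R : Fin 5 → Fin 5 → Prop) (i : Fin 5) : Prop :=
  ∃ j, j ≠ 4 ∧ i ≠ j ∧ (R i j ∨ ∃ m, R i m ∧ R m j)

instance (R : Fin 5 → Fin 5 → Prop) [DecidableRel R] : DecidablePred (HasNear R) := by
  unfold HasNear; infer_instance

/-- In every flip of `H` along two parts, among any two of the vertices `0, 1, 2, 3` there is one
that has another of these vertices at distance at most two. -/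
def RunnerSafe (H : SimpleGraph (Fin 5)) : Prop :=
  ∀ (t : Fin 5 → Bool) (F : Bool → Bool → Bool), (∀ x y, F x y = F y x) →
    ∀ i j, i ≠ 4 → j ≠ 4 → i ≠ j → HasNear (FlipAdj H t F) i ∨ HasNear (FlipAdj H t F) j

set_option synthInstance.maxSize 1000 in
set_option synthInstance.maxHeartbeats 200000 in
instance (H : SimpleGraph (Fin 5)) [DecidableRel H.Adj] : Decidable (RunnerSafe H) := by
  unfold RunnerSafe; infer_instance

theorem runnerSafe_c5 : RunnerSafe c5 := by decide +kernel

theorem runnerSafe_bull : RunnerSafe bull := by decide +kernel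

theorem runnerSafe_gem : RunnerSafe gem := by decide +kernel

theorem runnerSafe_coGem : RunnerSafe coGem := by decide +kernel

/-- `H` has no bi-join with at least two vertices on both sides: here `p` marks the sides and `g`
the sets `W₁` and `W₂`. -/
def BiJoinPrime (H : SimpleGraph (Fin 5)) : Prop :=
  ∀ p g : Fin 5 → Bool, (∃ i j, i ≠ j ∧ p i = true ∧ p j = true) →
    (∃ i j, i ≠ j ∧ p i = false ∧ p j = false) →
    ∃ i j, p i = true ∧ p j = false ∧ ¬ (H.Adj i j ↔ g i = g j)

set_option synthInstance.maxSize 1000 in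
set_option synthInstance.maxHeartbeats 200000 in
instance (H : SimpleGraph (Fin 5)) [DecidableRel H.Adj] : Decidable (BiJoinPrime H) := by
  unfold BiJoinPrime; infer_instance

theorem biJoinPrime_c5 : BiJoinPrime c5 := by decide +kernel

theorem biJoinPrime_bull : BiJoinPrime bull := by decide +kernel

theorem biJoinPrime_gem : BiJoinPrime gem := by decide +kernel

theorem biJoinPrime_coGem : BiJoinPrime coGem := by decide +kernel

/-- Adjacency in the graph obtained from the co-gem by switching along `s`. -/
def SwitchAdj (s : Fin 5 → Bool) (i j : Fin 5) : Prop :=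
  i ≠ j ∧ (coGem.Adj i j ↔ s i = s j)

instance (s : Fin 5 → Bool) : DecidableRel (SwitchAdj s) := by
  unfold SwitchAdj; infer_instance

/-- Complementing `s` gives the same switching, so vertex 4 may be given the value `false`; sixteen
cases remain, each settled by an explicit relabelling. -/
theorem exists_obstruction_switch (s₀ s₁ s₂ s₃ : Bool) :
    ∃ f : Fin 5 → Fin 5, Function.Injective f ∧
      ((∀ i j, SwitchAdj ![s₀, s₁, s₂, s₃, false] (f i) (f j) ↔ c5.Adj i j) ∨
      (∀ i j, SwitchAdj ![s₀, s₁, s₂, s₃, false] (f i) (f j) ↔ bull.Adj i j) ∨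
      (∀ i j, SwitchAdj ![s₀, s₁, s₂, s₃, false] (f i) (f j) ↔ gem.Adj i j) ∨
      (∀ i j, SwitchAdj ![s₀, s₁, s₂, s₃, false] (f i) (f j) ↔ coGem.Adj i j)) := by
  cases s₀ <;> cases s₁ <;> cases s₂ <;> cases s₃
  · exact ⟨![0, 1, 2, 3, 4], by decide, .inr (.inr (.inr (by decide)))⟩
  · exact ⟨![2, 1, 3, 4, 0], by decide, .inr (.inl (by decide))⟩
  · exact ⟨![1, 0, 2, 4, 3], by decide, .inr (.inr (.inr (by decide)))⟩
  · exact ⟨![1, 0, 2, 4, 3], by decide, .inr (.inr (.inl (by decide)))⟩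
  · exact ⟨![2, 3, 1, 4, 0], by decide, .inr (.inr (.inr (by decide)))⟩
  · exact ⟨![0, 3, 4, 1, 2], by decide, .inr (.inr (.inr (by decide)))⟩
  · exact ⟨![0, 2, 1, 3, 4], by decide, .inr (.inl (by decide))⟩
  · exact ⟨![0, 3, 4, 1, 2], by decide, .inr (.inr (.inl (by decide)))⟩
  · exact ⟨![1, 2, 0, 4, 3], by decide, .inr (.inl (by decide))⟩
  · exact ⟨![0, 2, 1, 3, 4], by decide, .inl (by decide)⟩
  · exact ⟨![2, 4, 0, 3, 1], by decide, .inr (.inr (.inr (by decide)))⟩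
  · exact ⟨![0, 4, 3, 1, 2], by decide, .inr (.inl (by decide))⟩
  · exact ⟨![2, 3, 1, 4, 0], by decide, .inr (.inr (.inl (by decide)))⟩
  · exact ⟨![2, 0, 4, 3, 1], by decide, .inr (.inl (by decide))⟩
  · exact ⟨![2, 4, 0, 3, 1], by decide, .inr (.inr (.inl (by decide)))⟩
  · exact ⟨![0, 1, 2, 3, 4], by decide, .inr (.inr (.inl (by decide)))⟩

end Obstructions

/-! ### The runner evades flips of width two -/

section Runner

variable {V : Type u}

/-- The runner's next move depends on graphs determined by all earlier positions, so the recursion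
runs on histories. -/
theorem exists_seq_of_history {α : Type*} (next : List α → α) :
    ∃ v : ℕ → α, ∀ n, v n = next ((List.range n).map v) := by
  let hist : ℕ → List α := fun n => Nat.rec [] (fun _ l => l ++ [next l]) n
  refine ⟨fun n => next (hist n), fun n => ?_⟩
  have h : hist n = (List.range n).map fun n => next (hist n) := by
    induction n with
    | zero => rfl
    | succ n ih =>
      rw [List.range_succ, List.map_append, ← ih]
      rfl
  exact congrArg next h

theorem CanMove.refl (r : ℕ∞) (K : SimpleGraph V) (u : V) : CanMove r K u u :=
  ⟨.nil, .nil, by simp⟩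

theorem CanMove.of_adj {r : ℕ∞} (hr : 2 ≤ r) {K : SimpleGraph V} {u v : V} (h : K.Adj u v) :
    CanMove r K u v := by
  refine ⟨h.toWalk, SimpleGraph.Walk.IsPath.of_adj h, ?_⟩
  refine le_trans ?_ hr
  simp

theorem CanMove.of_adj_adj {r : ℕ∞} (hr : 2 ≤ r) {K : SimpleGraph V} {u v w : V}
    (h : K.Adj u v) (h' : K.Adj v w) : CanMove r K u w := by
  classical
  -- This walk is not a path when `u = w`; `bypass` covers that case.
  let p : K.Walk u w := .cons h (.cons h' .nil)
  refine ⟨p.bypass, p.bypass_isPath, le_trans ?_ hr⟩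
  exact_mod_cast (p.length_bypass_le_length).trans (by simp [p])

/-- A runner who stays on the vertices `0, 1, 2, 3` of an induced copy of `H` is never caught by
flips along at most two parts. -/
theorem RunnerSafe.not_isWinning {H : SimpleGraph (Fin 5)} (hH : RunnerSafe H)
    {G : SimpleGraph V} (f : H ↪g G) {r : ℕ∞} (hr : 2 ≤ r) {k : ℕ} (hk1 : 1 ≤ k) (hk : k ≤ 2)
    (σ : Strategy G k) : ¬ σ.IsWinning r := by
  classical
  -- The empty history yields `G₀ = G`, itself a `k`-flip, so round 0 needs no special treatment.
  let gr : List V → SimpleGraph V := fun l => if l = [] then G else σ.move l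
  have hgr : ∀ l, IsKFlip k G (gr l) := by
    intro l
    by_cases hl : l = []
    · simpa [gr, hl] using isKFlip_self hk1 G
    · simpa [gr, hl] using σ.isKFlip l
  have hat : ∀ v i, σ.graphAt v i = gr ((List.range i).map v) := by
    intro v i
    cases i <;> simp [Strategy.graphAt, gr]
  let good : SimpleGraph V → Fin 5 → Prop := fun K i => i ≠ 4 ∧ HasNear (K.comap f).Adj i
  have hsafe : ∀ l i j, i ≠ 4 → j ≠ 4 → i ≠ j → good (gr l) i ∨ good (gr l) j := by
    intro l i j hi hj hij
    obtain ⟨t, F, hF, hadj⟩ := (hgr l).exists_bool hk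
    have : ((gr l).comap f).Adj = FlipAdj H (t ∘ f) F := by
      funext a b
      rcases eq_or_ne a b with rfl | hab
      · simp [FlipAdj]
      · simp [FlipAdj, hab, hadj _ _ (f.injective.ne hab)]
    have := this ▸ hH (t ∘ f) F hF i j hi hj hij
    exact this.imp (fun h => ⟨hi, h⟩) (fun h => ⟨hj, h⟩)
  have hmove : ∀ l l' i, good (gr l) i → ∃ j, good (gr l') j ∧ CanMove r (gr l) (f i) (f j) := by
    rintro l l' i ⟨hi, j, hj, hij, hnear⟩
    -- The announced graph `gr l'` leaves `i` or its near vertex `j` good, and both are reachable in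
    -- the old graph.
    rcases hsafe l' i j hi hj hij with h | h
    · exact ⟨i, h, .refl _ _ _⟩
    · refine ⟨j, h, ?_⟩
      rcases hnear with h1 | ⟨m, h1, h2⟩
      · exact .of_adj hr h1
      · exact .of_adj_adj hr h1 h2
  have hstart : ∃ i, good (gr []) i := by
    rcases hsafe [] 0 1 (by decide) (by decide) (by decide) with h | h
    exacts [⟨_, h⟩, ⟨_, h⟩]
  obtain ⟨i₀, hi₀⟩ := hstart
  choose! nx hnx using hmove
  -- Dropping the last position gives the graph moved in; the full history gives the graph just
  -- announced.
  obtain ⟨w, hw⟩ := exists_seq_of_history (fun l : List (Fin 5) =>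
    if h : l = [] then i₀ else nx (l.dropLast.map f) (l.map f) (l.getLast h))
  have hw0 : w 0 = i₀ := by rw [hw]; simp
  have hw1 : ∀ n, w (n + 1) = nx ((List.range n).map (f ∘ w)) ((List.range (n + 1)).map (f ∘ w))
      (w n) := by
    intro n
    rw [hw (n + 1)]
    simp [List.range_succ]
  have hgood : ∀ n, good (gr ((List.range n).map (f ∘ w))) (w n) := by
    intro n
    induction n with
    | zero => simpa [hw0] using hi₀
    | succ n ih =>
      rw [hw1]
      exact (hnx _ _ _ ih).1
  intro hwin
  obtain ⟨n, -, hn⟩ := hwin (f ∘ w) (by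
    intro n
    rw [hat]
    have := (hnx _ ((List.range (n + 1)).map (f ∘ w)) _ (hgood n)).2
    rwa [← hw1] at this)
  rw [hat] at hn
  obtain ⟨-, j, -, -, h | ⟨m, h, -⟩⟩ := hgood n
  exacts [hn _ h, hn _ h]

theorem RunnerSafe.three_le_flipWidth {H : SimpleGraph (Fin 5)} (hH : RunnerSafe H)
    {G : SimpleGraph V} (f : H ↪g G) {r : ℕ∞} (hr : 2 ≤ r) : 3 ≤ flipWidth r G := by
  refine le_iInf₂ fun k hk => ?_
  by_contra h
  have hk2 : k ≤ 2 := by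
    have : (k : ℕ∞) < (3 : ℕ) := not_le.1 h
    have := Nat.cast_lt.1 this
    omega
  obtain ⟨h1, σ, hσ⟩ := hk
  exact hH.not_isWinning f hr h1 hk2 σ hσ

theorem obsFree_of_flipWidth_le_two {G : SimpleGraph V} {r : ℕ∞} (hr : 2 ≤ r)
    (h : flipWidth r G ≤ 2) : ObsFree G := by
  have key : ∀ {H : SimpleGraph (Fin 5)}, RunnerSafe H → ¬ H.IsIndContained G := by
    rintro H hH ⟨f⟩
    exact absurd ((hH.three_le_flipWidth f hr).trans h) (by decide)
  exact ⟨key runnerSafe_c5, key runnerSafe_bull, key runnerSafe_gem, key runnerSafe_coGem⟩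

end Runner

/-! ### Splitting cographs -/

section Cographs

variable {V : Type u}

/-- `G` has no induced path on four vertices. -/
def P4Free (G : SimpleGraph V) : Prop :=
  ∀ a b c d, G.Adj a b → G.Adj b c → G.Adj c d → ¬ G.Adj a c → ¬ G.Adj b d → G.Adj a d

/-- P4 is self-complementary: the path `a b c d` becomes `c a d b`. -/
theorem P4Free.compl {G : SimpleGraph V} (h : P4Free G) : P4Free Gᶜ := by
  intro a b c d
  simp only [SimpleGraph.compl_adj]
  rintro ⟨hab, hab'⟩ ⟨hbc, hbc'⟩ ⟨hcd, hcd'⟩ hac hbd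
  have := h c a d b
  grind [SimpleGraph.adj_comm, SimpleGraph.irrefl]

/-- `A` and `B` partition `X`, and are complete (`c` true) or anticomplete (`c` false) to each
other. -/
structure IsSplit (G : SimpleGraph V) (X A B : Set V) (c : Prop) : Prop where
  union : A ∪ B = X
  disjoint : Disjoint A B
  left_nonempty : A.Nonempty
  right_nonempty : B.Nonempty
  adj_iff : ∀ a ∈ A, ∀ b ∈ B, (G.Adj a b ↔ c)

theorem IsSplit.symm {G : SimpleGraph V} {X A B : Set V} {c : Prop} (h : IsSplit G X A B c) :
    IsSplit G X B A c :=
  ⟨by rw [Set.union_comm, h.union], h.disjoint.symm, h.right_nonempty, h.left_nonempty,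
    fun a ha b hb => by rw [G.adj_comm, h.adj_iff b hb a ha]⟩

theorem IsSplit.of_compl {G : SimpleGraph V} {X A B : Set V} {c : Prop}
    (h : IsSplit Gᶜ X A B c) : IsSplit G X A B (¬ c) := by
  refine ⟨h.union, h.disjoint, h.left_nonempty, h.right_nonempty, fun a ha b hb => ?_⟩
  have hne : a ≠ b := by rintro rfl; exact Set.disjoint_left.1 h.disjoint ha hb
  rw [← h.adj_iff a ha b hb, SimpleGraph.compl_adj]
  tauto

/-- A set that is complete or anticomplete to the rest of `X` splits `X`. -/
theorem IsSplit.of_subset {G : SimpleGraph V} {X A : Set V} {c : Prop} (hA : A ⊆ X)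
    (hne : A.Nonempty) (hne' : (X \ A).Nonempty) (h : ∀ a ∈ A, ∀ b ∈ X \ A, (G.Adj a b ↔ c)) :
    IsSplit G X A (X \ A) c :=
  ⟨Set.union_sdiff_cancel hA, Set.disjoint_sdiff_right, hne, hne', h⟩

/-- The inductive step: adding a vertex to a set with an anticomplete split. -/
theorem IsSplit.exists_insert {G : SimpleGraph V} (hG : P4Free G) {X A B : Set V} {v : V}
    (hv : v ∉ X) (h : IsSplit G X A B False) :
    ∃ A B c, IsSplit G (insert v X) A B c := by
  have hXne : X.Nonempty := h.union ▸ h.left_nonempty.inl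
  by_cases hall : ∀ x ∈ X, G.Adj v x
  · refine ⟨{v}, insert v X \ {v}, True, .of_subset (by simp) (by simp) ?_ ?_⟩
    · simpa [hv] using hXne
    · rintro _ rfl b ⟨rfl | hb, hb'⟩
      · exact absurd rfl hb'
      · simp [hall b hb]
  push Not at hall
  obtain ⟨w, hwX, hw⟩ := hall
  wlog hwA : w ∈ A generalizing A B
  · exact this h.symm ((h.union ▸ hwX : w ∈ A ∪ B).resolve_left hwA)
  have hAX : A ⊆ X := h.union ▸ Set.subset_union_left
  have hBX : B ⊆ X := h.union ▸ Set.subset_union_right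
  by_cases hB : ∃ d ∈ B, G.Adj v d
  · obtain ⟨d, hd, hvd⟩ := hB
    by_cases hA : ∃ b ∈ A, ¬ G.Adj v b ∧ ∃ a ∈ A, G.Adj v a ∧ G.Adj b a
    -- Here `b a v d` would be an induced P4.
    · obtain ⟨b, hb, hvb, a, ha, hva, hba⟩ := hA
      have := hG b a v d hba hva.symm hvd (fun h => hvb h.symm) ((h.adj_iff a ha d hd).1)
      exact ((h.adj_iff b hb d hd).1 this).elim
    -- The non-neighbours of `v` in `A` are anticomplete to everything else.
    · push Not at hA
      refine ⟨{b ∈ A | ¬ G.Adj v b}, _, False, .of_subset ?_ ⟨w, hwA, hw⟩ ⟨v, ?_⟩ ?_⟩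
      · exact fun b hb => Or.inr (hAX hb.1)
      · exact ⟨Or.inl rfl, fun hh => hv (hAX hh.1)⟩
      · rintro b ⟨hb, hvb⟩ x ⟨rfl | hx, hx'⟩
        · simpa [G.adj_comm] using hvb
        · rw [← h.union] at hx
          rcases hx with hx | hx
          · have : G.Adj v x := by
              by_contra hvx
              exact hx' ⟨hx, hvx⟩
            simpa using hA b hb hvb x hx this
          · exact h.adj_iff b hb x hx
  · push Not at hB
    refine ⟨B, _, False, .of_subset (hBX.trans (Set.subset_insert _ _)) h.right_nonempty ⟨v, ?_⟩ ?_⟩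
    · exact ⟨Or.inl rfl, fun hh => hv (hBX hh)⟩
    · rintro b hb x ⟨rfl | hx, hx'⟩
      · simpa [G.adj_comm] using hB b hb
      · rw [← h.union] at hx
        rw [G.adj_comm]
        exact h.adj_iff x (hx.resolve_right hx') b hb

/-- In a graph without induced four-vertex paths, every finite set of at least two vertices is the
union of two nonempty parts that are complete or anticomplete to each other. -/
theorem P4Free.exists_isSplit {G : SimpleGraph V} (hG : P4Free G) {X : Set V} (hX : X.Finite)
    (hX2 : X.Nontrivial) : ∃ A B c, IsSplit G X A B c := by
  induction X, hX using Set.Finite.induction_on with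
  | empty => exact absurd hX2 (by simp)
  | @insert v X hv hX ih =>
    by_cases hXn : X.Nontrivial
    · obtain ⟨A, B, c, h⟩ := ih hXn
      by_cases hc : c
      · have h' : IsSplit Gᶜ X A B False := by
          have := IsSplit.of_compl (G := Gᶜ) (by rwa [compl_compl] : IsSplit Gᶜᶜ X A B c)
          simpa [hc] using this
        obtain ⟨A, B, c, h⟩ := h'.exists_insert hG.compl hv
        exact ⟨A, B, _, h.of_compl⟩
      · exact IsSplit.exists_insert hG hv (by simpa [hc] using h)
    · have hXne : X.Nonempty := by
        rw [Set.nonempty_iff_ne_empty]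
        rintro rfl
        simp at hX2
      obtain ⟨x, rfl⟩ := (Set.not_nontrivial_iff.1 hXn).eq_empty_or_singleton.resolve_left
        hXne.ne_empty
      refine ⟨{v}, {x}, G.Adj v x, by rw [Set.insert_eq], by simpa using hv, by simp, by simp, ?_⟩
      simp

end Cographs

/-! ### From obstruction-free graphs to cographs -/

section Switching

variable {V : Type u}

/-- Seidel switching of `G` along `s`. -/
def switch (G : SimpleGraph V) (s : V → Bool) : SimpleGraph V where
  Adj u v := u ≠ v ∧ (G.Adj u v ↔ s u = s v)
  symm := ⟨fun u v h => ⟨h.1.symm, by rw [G.adj_comm, h.2, eq_comm]⟩⟩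
  loopless := ⟨fun _ h => h.1 rfl⟩

theorem switch_adj {G : SimpleGraph V} {s : V → Bool} {u v : V} (h : u ≠ v) :
    (switch G s).Adj u v ↔ (G.Adj u v ↔ s u = s v) := by
  simp [switch, h]

theorem ObsFree.false_of_switch {G : SimpleGraph V} (hG : ObsFree G) {g : Fin 5 → V}
    (hg : Function.Injective g) {s : Fin 5 → Bool} (hs : s 4 = false)
    (h : ∀ i j, G.Adj (g i) (g j) ↔ SwitchAdj s i j) : False := by
  have hs' : s = ![s 0, s 1, s 2, s 3, false] := by
    funext i; fin_cases i <;> simp [hs]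
  obtain ⟨f, hinj, hf⟩ := exists_obstruction_switch (s 0) (s 1) (s 2) (s 3)
  rw [← hs'] at hf
  simp only [← h] at hf
  have key : ∀ {H : SimpleGraph (Fin 5)},
      (∀ i j, G.Adj (g (f i)) (g (f j)) ↔ H.Adj i j) → H.IsIndContained G :=
    fun hH => ⟨⟨⟨g ∘ f, hg.comp hinj⟩, fun {i j} => hH i j⟩⟩
  obtain ⟨h1, h2, h3, h4⟩ := hG
  rcases hf with hf | hf | hf | hf
  exacts [h1 (key hf), h2 (key hf), h3 (key hf), h4 (key hf)]

/-- An obstruction-free graph is a switching of a graph without induced four-vertex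
paths. -/
theorem ObsFree.exists_p4Free_switch {G : SimpleGraph V} (hG : ObsFree G) :
    ∃ s, P4Free (switch G s) := by
  classical
  rcases isEmpty_or_nonempty V with hV | ⟨⟨v⟩⟩
  · exact ⟨fun _ => true, fun a => (hV.false a).elim⟩
  -- Switching along the neighbourhood of `v` isolates `v`.
  refine ⟨fun u => decide (G.Adj v u), ?_⟩
  set s : V → Bool := fun u => decide (G.Adj v u) with hs
  set K := switch G s with hK
  have hv : ∀ x, ¬ K.Adj v x := by
    rintro x ⟨hne, h⟩
    simp [hs] at h
  have hv' : ∀ x, ¬ K.Adj x v := fun x h => hv x h.symm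
  intro a b c d hab hbc hcd hac hbd
  by_contra had
  have hadj : ∀ i j, K.Adj (![a, b, c, d, v] i) (![a, b, c, d, v] j) ↔ coGem.Adj i j := by
    have hca : ¬ K.Adj c a := fun h => hac h.symm
    have hdb : ¬ K.Adj d b := fun h => hbd h.symm
    have hda : ¬ K.Adj d a := fun h => had h.symm
    intro i j
    fin_cases i <;> fin_cases j <;>
      simp [hv, hv', hab, hbc, hcd, hab.symm, hbc.symm, hcd.symm, hac, hbd, had, hca, hdb, hda,
        coGem]
  have hinj : Function.Injective ![a, b, c, d, v] := by
    have h1 := hab.ne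
    have h2 := hbc.ne
    have h3 := hcd.ne
    have h4 : a ≠ c := by rintro rfl; exact had hcd
    have h5 : b ≠ d := by rintro rfl; exact had hab
    have h6 : a ≠ d := by rintro rfl; exact hac hcd.symm
    have h7 : a ≠ v := by rintro rfl; exact hv _ hab
    have h8 : b ≠ v := by rintro rfl; exact hv _ hbc
    have h9 : c ≠ v := by rintro rfl; exact hv _ hcd
    have h10 : d ≠ v := by rintro rfl; exact hv' _ hcd
    intro i j
    fin_cases i <;> fin_cases j <;>
      simp [h1, h2, h3, h4, h5, h6, h7, h8, h9, h10, h1.symm, h2.symm, h3.symm, h4.symm, h5.symm,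
        h6.symm, h7.symm, h8.symm, h9.symm, h10.symm]
  -- Switching is an involution, so these five vertices induce a switching of the co-gem in `G`; `s
  -- v = false` is the required normalisation.
  refine hG.false_of_switch hinj (s := s ∘ ![a, b, c, d, v]) (by simp [hs]) fun i j => ?_
  rcases eq_or_ne i j with rfl | hij
  · simp [SwitchAdj]
  · have h1 := hadj i j
    rw [hK, switch_adj (hinj.ne hij)] at h1
    simp only [SwitchAdj, Function.comp_apply, ← h1]
    tauto

end Switching

/-! ### Modules -/

section Modules

variable {V : Type u}

/-- Vertices outside `X` do not distinguish the vertices of `X`. -/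
def IsModule (G : SimpleGraph V) (X : Set V) : Prop :=
  ∃ h : V → Bool, ∀ x ∈ X, ∀ y ∉ X, (G.Adj x y ↔ h y = true)

theorem isModule_univ (G : SimpleGraph V) : IsModule G Set.univ :=
  ⟨fun _ => true, fun _ _ y hy => absurd (Set.mem_univ y) hy⟩

theorem isModule_empty (G : SimpleGraph V) : IsModule G ∅ :=
  ⟨fun _ => true, fun _ hx => hx.elim⟩

/-- A vertex outside `A` lies in `B`, which sees `A` uniformly through `c`, or outside `X`, where
`X` is a module. -/
theorem IsModule.of_isSplit {G : SimpleGraph V} {X A B : Set V} {c : Prop} (hX : IsModule G X)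
    (h : IsSplit G X A B c) : IsModule G A := by
  classical
  obtain ⟨f, hf⟩ := hX
  refine ⟨fun y => if y ∈ B then decide c else f y, fun x hx y hy => ?_⟩
  by_cases hyB : y ∈ B
  · simp [hyB, h.adj_iff x hx y hyB]
  · have hyX : y ∉ X := by
      rw [← h.union]
      exact fun hh => hh.elim hy hyB
    simpa [hyB] using hf x (h.union ▸ Or.inl hx) y hyX

theorem IsSplit.left_ssubset {G : SimpleGraph V} {X A B : Set V} {c : Prop}
    (h : IsSplit G X A B c) : A ⊂ X := by
  obtain ⟨b, hb⟩ := h.right_nonempty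
  refine (Set.ssubset_iff_of_subset (h.union ▸ Set.subset_union_left)).2 ⟨b, ?_, ?_⟩
  · exact h.union ▸ Or.inr hb
  · exact fun ha => Set.disjoint_left.1 h.disjoint ha hb

end Modules

/-! ### The flipper's strategy -/

section Flipper

variable {V : Type u}

/-- No edge of `K` leaves `X`. -/
def IsSeparated (K : SimpleGraph V) (X : Set V) : Prop :=
  ∀ x ∈ X, ∀ y ∉ X, ¬ K.Adj x y

theorem IsSeparated.mem_of_canMove {K : SimpleGraph V} {X : Set V} (h : IsSeparated K X) {r : ℕ∞}
    {u v : V} (hu : u ∈ X) (huv : CanMove r K u v) : v ∈ X := by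
  obtain ⟨p, -, -⟩ := huv
  induction p with
  | nil => exact hu
  | cons hadj _ ih =>
    refine ih ?_
    by_contra hn
    exact h _ hu _ hn hadj

/-- If `X` is a module of a switching of `G` and `A`, `B` partition `X` and are complete or
anticomplete to each other there, then a single 2-flip of `G` disconnects `A`, `B` and the
complement of `X` from each other. -/
theorem exists_isKFlip_isSeparated {G : SimpleGraph V} {s : V → Bool} {X A B : Set V} {c : Bool}
    (hX : IsModule (switch G s) X) (hun : A ∪ B = X) (hd : Disjoint A B)
    (hAB : ∀ a ∈ A, ∀ b ∈ B, ((switch G s).Adj a b ↔ c = true)) :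
    ∃ K, IsKFlip 2 G K ∧ IsSeparated K A ∧ IsSeparated K B := by
  classical
  obtain ⟨f, hf⟩ := hX
  -- Inside `X` this flip is the switching, complemented if `c` is true. Between `X` and an outside
  -- `y` the two `c` cancel, and `f y` complements exactly the pairs adjacent in the switching.
  obtain ⟨K, hK, hadj⟩ := exists_isKFlip_two G
    (fun x => if x ∈ X then s x else (s x ^^ f x ^^ c)) c
  have hAX : ∀ a ∈ A, a ∈ X := fun a ha => hun ▸ Or.inl ha
  have hBX : ∀ b ∈ B, b ∈ X := fun b hb => hun ▸ Or.inr hb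
  have h1 : ∀ a ∈ A, ∀ b ∈ B, ¬ K.Adj a b := by
    intro a ha b hb
    have hne : a ≠ b := by rintro rfl; exact Set.disjoint_left.1 hd ha hb
    have h2 := hAB a ha b hb
    rw [switch_adj hne] at h2
    rw [hadj a b hne]
    simp only [hAX a ha, hBX b hb, if_true]
    revert h2
    cases s a <;> cases s b <;> cases c <;> simp
  have h2 : ∀ x ∈ X, ∀ y ∉ X, ¬ K.Adj x y := by
    intro x hx y hy
    have hne : x ≠ y := by rintro rfl; exact hy hx
    have h2 := hf x hx y hy
    rw [switch_adj hne] at h2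
    rw [hadj x y hne]
    simp only [hx, hy, if_true, if_false]
    revert h2
    cases s x <;> cases s y <;> cases c <;> cases f y <;> simp
  refine ⟨K, hK, fun a ha y hy => ?_, fun b hb y hy => ?_⟩
  · by_cases hyX : y ∈ X
    · exact h1 a ha y ((hun.symm ▸ hyX : y ∈ A ∪ B).resolve_left hy)
    · exact h2 a (hAX a ha) y hyX
  · by_cases hyX : y ∈ X
    · exact fun h => h1 y ((hun.symm ▸ hyX : y ∈ A ∪ B).resolve_right hy) b hb h.symm
    · exact h2 b (hBX b hb) y hyX

/-- One step of the flipper's strategy: a 2-flip that confines a runner in the module `X` to a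
smaller module. -/
theorem exists_confining_flip [Finite V] {G : SimpleGraph V} {s : V → Bool}
    (hs : P4Free (switch G s)) {X : Set V} (hX : IsModule (switch G s) X) :
    ∃ (K : SimpleGraph V) (A B : Set V), IsKFlip 2 G K ∧ A ∪ B = X ∧
      (IsModule (switch G s) A ∧ IsSeparated K A) ∧ (IsModule (switch G s) B ∧ IsSeparated K B) ∧
      (X.Nontrivial → A ⊂ X ∧ B ⊂ X) := by
  classical
  by_cases hn : X.Nontrivial
  · obtain ⟨A, B, c, h⟩ := hs.exists_isSplit X.toFinite hn
    obtain ⟨K, hK, h1, h2⟩ := exists_isKFlip_isSeparated (c := decide c) hX h.union h.disjoint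
      (by simpa using h.adj_iff)
    exact ⟨K, A, B, hK, h.union, ⟨hX.of_isSplit h, h1⟩, ⟨hX.of_isSplit h.symm, h2⟩,
      fun _ => ⟨h.left_ssubset, h.symm.left_ssubset⟩⟩
  · obtain ⟨K, hK, h1, h2⟩ := exists_isKFlip_isSeparated (A := X) (B := ∅) (c := true) hX (by simp)
      (by simp) (by simp)
    exact ⟨K, X, ∅, hK, by simp, ⟨hX, h1⟩, ⟨isModule_empty _, h2⟩, fun h => absurd h hn⟩

/-- The confining module shrinks strictly while it has two vertices; once it is a single vertex, the
runner is isolated. -/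
theorem ObsFree.exists_isWinning [Finite V] {G : SimpleGraph V} (hG : ObsFree G) (r : ℕ∞) :
    ∃ σ : Strategy G 2, σ.IsWinning r := by
  classical
  obtain ⟨s, hs⟩ := hG.exists_p4Free_switch
  have step : ∀ X : Set V, ∃ (K : SimpleGraph V) (A B : Set V), IsKFlip 2 G K ∧
      (IsModule (switch G s) X → A ∪ B = X ∧
      (IsModule (switch G s) A ∧ IsSeparated K A) ∧ (IsModule (switch G s) B ∧ IsSeparated K B) ∧
      (X.Nontrivial → A ⊂ X ∧ B ⊂ X)) := by
    intro X
    by_cases hX : IsModule (switch G s) X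
    · obtain ⟨K, A, B, hK, h⟩ := exists_confining_flip hs hX
      exact ⟨K, A, B, hK, fun _ => h⟩
    · exact ⟨G, ∅, ∅, isKFlip_self (by norm_num) G, fun h => absurd h hX⟩
  choose K A B hK hstep using step
  let part : Set V → V → Set V := fun X v => if v ∈ A X then A X else B X
  -- `v₀` is dropped: nothing confines the runner in `G₀`, so the first module is everything.
  refine ⟨⟨fun l => K (l.tail.foldl part Set.univ), fun l => hK _⟩, fun v hv => ?_⟩
  by_contra! hiso
  let X : ℕ → Set V := fun i => ((List.range i).map fun j => v (j + 1)).foldl part Set.univ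
  have hXs : ∀ i, X (i + 1) = part (X i) (v (i + 1)) := by
    intro i
    simp [X, List.range_succ]
  set σ : Strategy G 2 := ⟨fun l => K (l.tail.foldl part Set.univ), fun l => hK _⟩ with hσ
  have hgr : ∀ i, σ.graphAt v (i + 1) = K (X i) := by
    intro i
    simp [Strategy.graphAt, hσ, X, List.range_succ_eq_map, Function.comp_def]
  have hinv : ∀ i, IsModule (switch G s) (X i) ∧ v i ∈ X i ∧ IsSeparated (σ.graphAt v i) (X i) ∧
      ((X i).Nontrivial → X (i + 1) ⊂ X i) := by
    intro i
    have haux : ∀ i, IsModule (switch G s) (X i) → ((X i).Nontrivial → X (i + 1) ⊂ X i) := by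
      intro i hm hn
      obtain ⟨-, -, -, h⟩ := hstep _ hm
      rw [hXs]
      by_cases hvA : v (i + 1) ∈ A (X i)
      · simpa [part, hvA] using (h hn).1
      · simpa [part, hvA] using (h hn).2
    suffices h : IsModule (switch G s) (X i) ∧ v i ∈ X i ∧ IsSeparated (σ.graphAt v i) (X i) from
      ⟨h.1, h.2.1, h.2.2, haux i h.1⟩
    induction i with
    | zero =>
      exact ⟨isModule_univ _, Set.mem_univ _, fun _ _ y hy => absurd (Set.mem_univ y) hy⟩
    | succ i ih =>
      obtain ⟨hm, hmem, hsep⟩ := ih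
      have hnext := hsep.mem_of_canMove hmem (hv i)
      obtain ⟨hun, hA, hB, -⟩ := hstep _ hm
      rw [hXs, hgr]
      by_cases hvA : v (i + 1) ∈ A (X i)
      · simpa [part, hvA] using ⟨hA.1, hA.2⟩
      · have : v (i + 1) ∈ B (X i) :=
          (hun.symm ▸ hnext : v (i + 1) ∈ A (X i) ∪ B (X i)).resolve_left hvA
        simpa [part, hvA] using ⟨hB.1, this, hB.2⟩
  -- Indices start at 1 because round 0 does not count as a capture.
  have hnt : ∀ i, (X (i + 1)).Nontrivial := by
    intro i
    by_contra hn
    obtain ⟨-, hmem, hsep, -⟩ := hinv (i + 1)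
    refine hiso (i + 1) (by omega) fun w hw => ?_
    refine hsep _ hmem w (fun hwX => ?_) hw
    exact hw.ne (Set.not_nontrivial_iff.1 hn hmem hwX)
  have hcard : ∀ i, (X (i + 1)).ncard + i ≤ (X 1).ncard := by
    intro i
    induction i with
    | zero => simp
    | succ i ih =>
      have := Set.ncard_lt_ncard ((hinv (i + 1)).2.2.2 (hnt i)) (Set.toFinite _)
      omega
  have := hcard ((X 1).ncard + 1)
  omega

theorem ObsFree.flipWidth_le_two [Finite V] {G : SimpleGraph V} (hG : ObsFree G) (r : ℕ∞) :
    flipWidth r G ≤ 2 :=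
  iInf₂_le 2 ⟨by norm_num, hG.exists_isWinning r⟩

end Flipper

/-! ### Bi-joins and total decomposability -/

section BiJoins

variable {V : Type u}

/-- A nonempty proper module of a switching of `G` is a side of a bi-join of `G`. -/
theorem IsModule.isBiJoin {G : SimpleGraph V} {s : V → Bool} {X : Set V}
    (hX : IsModule (switch G s) X) (hne : X.Nonempty) (hne' : Xᶜ.Nonempty) :
    IsBiJoin G X Xᶜ := by
  obtain ⟨f, hf⟩ := hX
  have key : ∀ x ∈ X, ∀ y ∉ X, (G.Adj x y ↔ (f y = true ↔ s x = s y)) := by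
    intro x hx y hy
    have hne : x ≠ y := by rintro rfl; exact hy hx
    have := hf x hx y hy
    rw [switch_adj hne] at this
    tauto
  -- By `key`, `x ∈ X` and `y ∉ X` are adjacent iff `s x = true` and `s y = f y` are equivalent,
  -- which dictates `W₁` and `W₂`.
  refine ⟨hne, hne', by simp, by simp, {x ∈ X | s x = true}, fun x hx => hx.1,
    {y ∈ Xᶜ | s y = f y}, fun y hy => hy.1, ?_, ?_, ?_, ?_⟩
  · rintro x ⟨hx, hx'⟩ y ⟨hy, hy'⟩
    rw [key x hx y hy, hx', ← hy', eq_comm]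
  · rintro x ⟨hx, hx'⟩ y ⟨hy, hy'⟩
    rw [key x hx y hy, hx']
    have : s y ≠ f y := fun h => hy' ⟨hy, h⟩
    revert this
    cases s y <;> cases f y <;> simp
  · rintro x ⟨hx, hx'⟩ y ⟨hy, hy'⟩
    rw [key x hx y hy]
    have : s y ≠ f y := fun h => hy' ⟨hy, h⟩
    have : s x ≠ true := fun h => hx' ⟨hx, h⟩
    revert this
    revert ‹s y ≠ f y›
    cases s x <;> cases s y <;> cases f y <;> simp
  · rintro x ⟨hx, hx'⟩ y ⟨hy, hy'⟩
    rw [key x hx y hy]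
    have : s x ≠ true := fun h => hx' ⟨hx, h⟩
    revert this
    revert hy'
    cases s x <;> cases s y <;> cases f y <;> simp

/-- A graph without induced four-vertex paths on at least four vertices has a module with at least
two vertices inside and at least two outside. -/
theorem P4Free.exists_isModule [Finite V] {G : SimpleGraph V} (hG : P4Free G)
    (h4 : 4 ≤ Nat.card V) : ∃ X, IsModule G X ∧ 2 ≤ X.ncard ∧ 2 ≤ Xᶜ.ncard := by
  have hsplit : ∀ Y : Set V, 2 ≤ Y.ncard → IsModule G Y → ∃ A B : Set V, IsModule G A ∧
      A ⊆ Y ∧ A.ncard + B.ncard = Y.ncard ∧ 1 ≤ B.ncard ∧ B.ncard ≤ A.ncard := by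
    intro Y hY hm
    obtain ⟨A, B, c, h⟩ := hG.exists_isSplit Y.toFinite
      (Set.one_lt_ncard_iff_nontrivial.1 hY)
    wlog hle : B.ncard ≤ A.ncard generalizing A B
    · exact this B A h.symm (by omega)
    refine ⟨A, B, hm.of_isSplit h, h.left_ssubset.subset, ?_, ?_, hle⟩
    · rw [← h.union, Set.ncard_union_eq h.disjoint]
    · exact (Set.ncard_pos).2 h.right_nonempty
  have hcompl : ∀ X : Set V, X.ncard + Xᶜ.ncard = Nat.card V := fun X => Set.ncard_add_ncard_compl X
  have huniv : (Set.univ : Set V).ncard = Nat.card V := Set.ncard_univ V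
  obtain ⟨A, B, hA, -, hAB, hB1, hBA⟩ := hsplit Set.univ (by omega) (isModule_univ G)
  by_cases hB : 2 ≤ B.ncard
  · exact ⟨A, hA, by omega, by have := hcompl A; omega⟩
  -- If `B` is a single vertex, then `A` has at least three; its larger half `C` has at least two
  -- and misses both `B` and `D`.
  · obtain ⟨C, D, hC, -, hCD, hD1, hDC⟩ := hsplit A (by omega) hA
    exact ⟨C, hC, by omega, by have := hcompl C; omega⟩

theorem ObsFree.induce {G : SimpleGraph V} (hG : ObsFree G) (S : Set V) :
    ObsFree (G.induce S) := by
  have hS : (G.induce S).IsIndContained G := ⟨SimpleGraph.Embedding.induce S⟩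
  exact ⟨fun h => hG.1 (h.trans hS), fun h => hG.2.1 (h.trans hS),
    fun h => hG.2.2.1 (h.trans hS), fun h => hG.2.2.2 (h.trans hS)⟩

theorem ObsFree.completelyDecomposable [Finite V] {G : SimpleGraph V} (hG : ObsFree G) :
    CompletelyDecomposable G := by
  intro S hS
  obtain ⟨s, hs⟩ := (hG.induce S).exists_p4Free_switch
  have hcard : 4 ≤ Nat.card S := by
    rw [← S.toFinite.cast_ncard_eq] at hS
    exact_mod_cast hS
  obtain ⟨X, hX, h1, h2⟩ := hs.exists_isModule hcard
  have hne : ∀ Y : Set S, 2 ≤ Y.ncard → Y.encard ≠ 1 := by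
    intro Y hY h
    rw [Set.ncard_def, h] at hY
    simp at hY
  refine ⟨X, Xᶜ, hX.isBiJoin ?_ ?_, hne _ h1, hne _ h2⟩ <;>
  exact (Set.ncard_pos).1 (by omega)

/-- Apply the decomposition to the five-vertex copy of `H` and pull its bi-join back: across the
sides, adjacency means lying both inside or both outside `W₁ ∪ W₂`. -/
theorem BiJoinPrime.not_isIndContained {H : SimpleGraph (Fin 5)} (hH : BiJoinPrime H)
    {G : SimpleGraph V} (hG : CompletelyDecomposable G) : ¬ H.IsIndContained G := by
  classical
  rintro ⟨f⟩
  have hcard : (Set.range f).encard = 5 := by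
    rw [← Set.image_univ, f.injective.encard_image, Set.encard_univ,
      ENat.card_eq_coe_fintype_card, Fintype.card_fin]
    rfl
  obtain ⟨V₁, V₂, ⟨hne₁, hne₂, hd, hun, W₁, hW₁, W₂, hW₂, h11, h12, h22, h21⟩, hV₁, hV₂⟩ :=
    hG (Set.range f) (by rw [hcard]; decide)
  let g : Fin 5 → Set.range f := fun i => ⟨f i, i, rfl⟩
  have hg : ∀ x, ∃ i, g i = x := by
    rintro ⟨_, i, rfl⟩
    exact ⟨i, rfl⟩
  have hpair : ∀ Y : Set (Set.range f), Y.Nonempty → Y.encard ≠ 1 →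
      ∃ i j, i ≠ j ∧ g i ∈ Y ∧ g j ∈ Y := by
    intro Y hY hY1
    have : Y.Nontrivial := by
      by_contra hn
      obtain ⟨x, rfl⟩ := (Set.not_nontrivial_iff.1 hn).eq_empty_or_singleton.resolve_left
        hY.ne_empty
      simp at hY1
    obtain ⟨x, hx, y, hy, hxy⟩ := this
    obtain ⟨i, rfl⟩ := hg x
    obtain ⟨j, rfl⟩ := hg y
    exact ⟨i, j, fun h => hxy (h ▸ rfl), hx, hy⟩
  have hV2 : ∀ x, x ∈ V₂ ↔ x ∉ V₁ := by
    intro x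
    have h1 : x ∈ V₁ ∪ V₂ := hun ▸ Set.mem_univ x
    refine ⟨fun h2 h1 => ?_, h1.resolve_left⟩
    exact (hd ▸ (⟨h1, h2⟩ : x ∈ V₁ ∩ V₂) : x ∈ (∅ : Set _))
  obtain ⟨i₁, j₁, hij₁, hi₁, hj₁⟩ := hpair V₁ hne₁ hV₁
  obtain ⟨i₂, j₂, hij₂, hi₂, hj₂⟩ := hpair V₂ hne₂ hV₂
  obtain ⟨i, j, hi, hj, hij⟩ := hH (fun i => decide (g i ∈ V₁))
    (fun i => decide (g i ∈ W₁ ∪ W₂)) ⟨i₁, j₁, hij₁, by simpa using hi₁, by simpa using hj₁⟩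
    ⟨i₂, j₂, hij₂, by simpa [hV2] using hi₂, by simpa [hV2] using hj₂⟩
  have hi : g i ∈ V₁ := by simpa using hi
  have hj' : g j ∉ V₁ := by simpa using hj
  have hj : g j ∈ V₂ := (hV2 _).2 hj'
  have hadj : H.Adj i j ↔ (G.induce (Set.range f)).Adj (g i) (g j) := by
    simp [g]
  have hi2 : g i ∉ W₂ := fun h => (hV2 _).1 (hW₂ h) hi
  have hj1 : g j ∉ W₁ := fun h => hj' (hW₁ h)
  apply hij
  rw [hadj, decide_eq_decide]
  simp only [Set.mem_union, hi2, hj1, or_false, false_or]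
  by_cases h1 : g i ∈ W₁ <;> by_cases h2 : g j ∈ W₂
  · simpa [h1, h2] using h11 _ h1 _ h2
  · simpa [h1, h2] using h12 _ h1 _ ⟨hj, h2⟩
  · simpa [h1, h2] using h21 _ ⟨hi, h1⟩ _ h2
  · simpa [h1, h2] using h22 _ ⟨hi, h1⟩ _ ⟨hj, h2⟩

theorem CompletelyDecomposable.obsFree {G : SimpleGraph V} (hG : CompletelyDecomposable G) :
    ObsFree G :=
  ⟨biJoinPrime_c5.not_isIndContained hG, biJoinPrime_bull.not_isIndContained hG,
    biJoinPrime_gem.not_isIndContained hG, biJoinPrime_coGem.not_isIndContained hG⟩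

end BiJoins

end FlipWidth

theorem theorem1 :
    (∀ (V : Type u) [Finite V] (G : SimpleGraph V),
      (∀ r : ℕ∞, 2 ≤ r → (FlipWidth.flipWidth r G ≤ 2 ↔ FlipWidth.ObsFree G)) ∧
      (FlipWidth.ObsFree G ↔ FlipWidth.CompletelyDecomposable G) ∧
      (FlipWidth.ObsFree G → ∀ r : ℕ∞, 1 ≤ r → FlipWidth.flipWidth r G ≤ 2)) ∧
    (∀ r : ℕ∞, 2 ≤ r →
      3 ≤ FlipWidth.flipWidth r FlipWidth.c5 ∧ 3 ≤ FlipWidth.flipWidth r FlipWidth.bull ∧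
      3 ≤ FlipWidth.flipWidth r FlipWidth.gem ∧ 3 ≤ FlipWidth.flipWidth r FlipWidth.coGem) := by
  refine ⟨fun V _ G => ⟨fun r hr => ⟨FlipWidth.obsFree_of_flipWidth_le_two hr,
    fun hG => hG.flipWidth_le_two r⟩, ⟨fun hG => hG.completelyDecomposable, fun hG => hG.obsFree⟩,
    fun hG r _ => hG.flipWidth_le_two r⟩, fun r hr => ⟨?_, ?_, ?_, ?_⟩⟩
  · exact FlipWidth.runnerSafe_c5.three_le_flipWidth .refl hr
  · exact FlipWidth.runnerSafe_bull.three_le_flipWidth .refl hr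
  · exact FlipWidth.runnerSafe_gem.three_le_flipWidth .refl hr
  · exact FlipWidth.runnerSafe_coGem.three_le_flipWidth .refl hr
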